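/- Let $q$ be a prime power, let $\overline{\mathbb F}_q$ be an algebraic closure of $\mathbb F_q$, and let $G=\mathrm{PGL}_2(\mathbb F_q)$ act on $\overline{\mathbb F}_q\cup\{\infty\}$ by $\begin{pmatrix}a&b\\c&d\end{pmatrix}(v)=\frac{av+b}{cv+d}$. A rational function $Q\in\mathbb F_q(x)$, written in lowest terms as $Q=f/g$, is called a quotient map for $G$ if $Q(\gamma(x))=Q(x)$ for all $\gamma\in G$ and $|G|=\deg f>\deg g$. An element $\tau\in\overline{\mathbb F}_q\cup\{\infty\}$ is called regular with respect to $Q$ if $Q^{-1}(\tau)\subset\overline{\mathbb F}_q\cup\{\infty\}$ has exactly $|G|$ elements, and irregular otherwise. If $\tau\in\mathbb F_q$ is regular, its Artin invariant $\mathrm{inv}_Q(\tau)$ is the conjugacy class in $G$ of an element $\gamma$ such that $v^q=\gamma(v)$ for some $v\in\overline{\mathbb F}_q$ with $Q(v)=\tau$ (such $\gamma$ exists for every such $v$, and the class does not depend on the choices). For $\gamma\in G$ represented by $\begin{pmatrix}a&b\\c&d\end{pmatrix}$ put $\iota(\gamma)=(a+d)^2/(ad-bc)$; this depends only on the conjugacy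 class of $\gamma$ in $G$. Theorem. Let $$Q(x)=\frac{(x^{q^2}-x)^{q+1}}{(x^q-x)^{q^2+1}}.$$ Then: 1. $Q$ is a quotient map for $\mathrm{PGL}_2(\mathbb F_q)$, and its only irregular values in $\overline{\mathbb F}_q\cup\{\infty\}$ are $0$ and $\infty$. 2. For every $\tau\in\mathbb F_q^\times$ the Artin invariant $\mathrm{inv}_Q(\tau)$ is well defined. 3. The map $\iota$ induces a bijection from the set of conjugacy classes of elements of order $\ge 3$ in $\mathrm{PGL}_2(\mathbb F_q)$ onto $\mathbb F_q^\times$, and the inverse bijection is $\tau\mapsto\mathrm{inv}_Q(\tau)$. 4. If $\gamma\in\mathrm{PGL}_2(\mathbb F_q)$ has order $\ge 3$, and $v\in\overline{\mathbb F}_q\setminus\mathbb F_q$ satisfies $v^q=\gamma(v)$, then $Q(v)=\iota(\gamma)$. -/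

import Mathlib

open scoped MatrixGroups

namespace PGL2Artin

open Matrix OnePoint

section Action

open scoped Classical in
/-- The action of `GL₂(K)` on `L ∪ {∞}`, for an extension `L / K`, by Möbius transformations
(obtained from Mathlib's action of `GL₂(L)`). -/
noncomputable def glAct {K : Type*} (L : Type*) [Field K] [Field L] [Algebra K L]
    (g : GL (Fin 2) K) (x : OnePoint L) : OnePoint L :=
  (g.map (algebraMap K L)) • x

variable {K L : Type*} [Field K] [Field L] [Algebra K L]

open scoped Classical in
theorem glAct_coe (g : GL (Fin 2) K) (v : L) :
    glAct L g (v : OnePoint L) =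
      if algebraMap K L (g 1 0) * v + algebraMap K L (g 1 1) = 0 then ∞
      else (((algebraMap K L (g 0 0) * v + algebraMap K L (g 0 1)) /
        (algebraMap K L (g 1 0) * v + algebraMap K L (g 1 1)) : L) : OnePoint L) := by
  simp [glAct, OnePoint.smul_some_eq_ite]

open scoped Classical in
theorem glAct_infty (g : GL (Fin 2) K) :
    glAct L g ∞ = if algebraMap K L (g 1 0) = 0 then ∞
      else ((algebraMap K L (g 0 0) / algebraMap K L (g 1 0) : L) : OnePoint L) := by
  simp [glAct, OnePoint.smul_infty_eq_ite]

theorem glAct_mul (g h : GL (Fin 2) K) (x : OnePoint L) :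
    glAct L (g * h) x = glAct L g (glAct L h x) := by
  simp [glAct, mul_smul]

theorem glAct_one (x : OnePoint L) : glAct L (1 : GL (Fin 2) K) x = x := by
  simp [glAct]

theorem glAct_scalar (u : Kˣ) (x : OnePoint L) :
    glAct L (Matrix.GeneralLinearGroup.scalar (Fin 2) u) x = x := by
  have hu : algebraMap K L (u : K) ≠ 0 := by simp
  cases x with
  | infty => simp [glAct_infty, Matrix.scalar_apply]
  | coe v =>
    rw [glAct_coe]
    simp [Matrix.scalar_apply, mul_div_cancel_left₀ _ hu]

/-- The action of `PGL₂(K)` on `L ∪ {∞}` by Möbius transformations. -/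
noncomputable instance : MulAction PGL(2, K) (OnePoint L) where
  smul γ x := Quotient.liftOn' γ (fun g => glAct L g x) (by
    intro g h hgh
    obtain ⟨u, hu⟩ := Matrix.ProjGenLinGroup.mk_eq_mk_iff.1
      (Quotient.sound' hgh : Matrix.ProjGenLinGroup.mk g = Matrix.ProjGenLinGroup.mk h)
    rw [← hu, glAct_mul, glAct_scalar])
  one_smul x := glAct_one x
  mul_smul γ δ x := by
    induction γ using Matrix.ProjGenLinGroup.induction_on with | mk g =>
    induction δ using Matrix.ProjGenLinGroup.induction_on with | mk h =>
    exact glAct_mul g h x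

theorem mk_smul (g : GL (Fin 2) K) (x : OnePoint L) :
    (Matrix.ProjGenLinGroup.mk g : PGL(2, K)) • x = glAct L g x := rfl

end Action

section Quotient

variable {K : Type*} [Field K]

/-- The element `γ(x) = (a x + b) / (c x + d)` of `K(x)`. -/
noncomputable def mobius (g : GL (Fin 2) K) : RatFunc K :=
  (RatFunc.C (g 0 0) * RatFunc.X + RatFunc.C (g 0 1)) /
    (RatFunc.C (g 1 0) * RatFunc.X + RatFunc.C (g 1 1))

/-- `Q ∈ K(x)` is a quotient map for the subgroup `G` of `PGL₂(K)`: `Q(γ(x)) = Q(x)` for all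
`γ ∈ G`, and if `Q = f / g` in lowest terms then `|G| = deg f > deg g`. -/
structure IsQuotientMap (G : Subgroup PGL(2, K)) (Q : RatFunc K) : Prop where
  invariant : ∀ g : GL (Fin 2) K, Matrix.ProjGenLinGroup.mk g ∈ G →
    RatFunc.eval RatFunc.C (mobius g) Q = Q
  natDegree_num : Q.num.natDegree = Nat.card G
  natDegree_denom_lt : Q.denom.natDegree < Q.num.natDegree

open scoped Classical in
/-- The value in `L ∪ {∞}` of a rational function `Q ∈ K(x)` at a point of `L ∪ {∞}`. At `∞` it is
the quotient of the coefficients of `x ^ N`, where `N` is the maximum of the degrees of the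
numerator and the denominator. -/
noncomputable def value {L : Type*} [Field L] [Algebra K L] (Q : RatFunc K) :
    OnePoint L → OnePoint L
  | OnePoint.some v =>
      if Polynomial.aeval v Q.denom = 0 then ∞
      else ((Polynomial.aeval v Q.num / Polynomial.aeval v Q.denom : L) : OnePoint L)
  | OnePoint.infty =>
      let N := max Q.num.natDegree Q.denom.natDegree
      if Q.denom.coeff N = 0 then ∞
      else ((algebraMap K L (Q.num.coeff N / Q.denom.coeff N) : L) : OnePoint L)

/-- `τ ∈ L ∪ {∞}` is regular with respect to `Q` and `G` if its fibre `Q⁻¹(τ)` has `|G|` elements.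
(Used with `L` an algebraic closure of `K`.) -/
def IsRegular {L : Type*} [Field L] [Algebra K L] (G : Subgroup PGL(2, K)) (Q : RatFunc K)
    (τ : OnePoint L) : Prop :=
  Nat.card {w : OnePoint L // value Q w = τ} = Nat.card G

end Quotient

section Finite

variable {F : Type*} [Field F]

/-- `C` is the Artin invariant `inv_Q(τ)` of `τ ∈ 𝔽_q`, where `Q` is a quotient map for the whole
group `PGL₂(𝔽_q)` and `L` is an algebraic closure of `𝔽_q`: `τ` is regular and, whenever
`Q(v) = τ`, there is `γ` with `v ^ q = γ(v)`, and `C` is the conjugacy class of any such `γ`. -/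
def IsArtinInvariant (L : Type*) [Field L] [Algebra F L] (Q : RatFunc F) (τ : F)
    (C : ConjClasses PGL(2, F)) : Prop :=
  IsRegular (⊤ : Subgroup PGL(2, F)) Q ((algebraMap F L τ : L) : OnePoint L) ∧
  ∀ v : L, value Q (v : OnePoint L) = ((algebraMap F L τ : L) : OnePoint L) →
    (∃ γ : PGL(2, F), ((v ^ Nat.card F : L) : OnePoint L) = γ • (v : OnePoint L)) ∧
    ∀ γ : PGL(2, F), ((v ^ Nat.card F : L) : OnePoint L) = γ • (v : OnePoint L) →
      ConjClasses.mk γ = C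

/-- The Artin invariant `inv_Q(τ)` as a function of `τ ∈ 𝔽_q` (arbitrary if it is undefined). -/
noncomputable def artinInvariant (L : Type*) [Field L] [Algebra F L] (Q : RatFunc F) (τ : F) :
    ConjClasses PGL(2, F) :=
  Classical.epsilon (IsArtinInvariant L Q τ)

/-- The rational function `(x^(q²) - x)^(q+1) / (x^q - x)^(q²+1)`, where `q = |F|`. -/
noncomputable def quotientMap (F : Type*) [Field F] : RatFunc F :=
  (RatFunc.X ^ (Nat.card F ^ 2) - RatFunc.X) ^ (Nat.card F + 1) /
    (RatFunc.X ^ Nat.card F - RatFunc.X) ^ (Nat.card F ^ 2 + 1)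

/-- `ι(g) = (a + d)² / (a d - b c)` on `GL₂`. -/
def iotaGL (g : GL (Fin 2) F) : F :=
  (g 0 0 + g 1 1) ^ 2 / (g 0 0 * g 1 1 - g 0 1 * g 1 0)

theorem iotaGL_eq (g : GL (Fin 2) F) : iotaGL g = g.val.trace ^ 2 / g.val.det := by
  rw [iotaGL, Matrix.trace_fin_two, Matrix.det_fin_two]

theorem iotaGL_mul_scalar (g : GL (Fin 2) F) (u : Fˣ) :
    iotaGL (g * Matrix.GeneralLinearGroup.scalar (Fin 2) u) = iotaGL g := by
  have hu : (u : F) ^ 2 ≠ 0 := by simp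
  have h : ∀ i j, (g * Matrix.GeneralLinearGroup.scalar (Fin 2) u) i j = u * g i j := by
    intro i j
    simp [mul_comm]
  simp only [iotaGL, h]
  rw [← mul_div_mul_left ((g 0 0 + g 1 1) ^ 2) _ hu]
  ring

theorem iotaGL_conj (g h : GL (Fin 2) F) : iotaGL (h * g * h⁻¹) = iotaGL g := by
  rw [iotaGL_eq, iotaGL_eq]
  have e : (h * g * h⁻¹).val = h.val * g.val * (h⁻¹).val := rfl
  have hh : (h⁻¹).val * h.val = 1 := by rw [← Units.val_mul]; simp
  have hd : (h⁻¹).val.det * h.val.det = 1 := by rw [← Matrix.det_mul, hh, Matrix.det_one]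
  rw [e, Matrix.trace_mul_comm, ← mul_assoc, hh, one_mul, Matrix.det_mul, Matrix.det_mul]
  congr 1
  linear_combination g.val.det * hd

/-- `ι` on `PGL₂`. -/
def iota (γ : PGL(2, F)) : F :=
  Quotient.liftOn' γ iotaGL (by
    intro g h hgh
    obtain ⟨u, hu⟩ := Matrix.ProjGenLinGroup.mk_eq_mk_iff.1
      (Quotient.sound' hgh : Matrix.ProjGenLinGroup.mk g = Matrix.ProjGenLinGroup.mk h)
    rw [← hu, iotaGL_mul_scalar])

theorem iota_mk (g : GL (Fin 2) F) : iota (Matrix.ProjGenLinGroup.mk g) = iotaGL g := rfl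

theorem iota_conj (γ δ : PGL(2, F)) : iota (δ * γ * δ⁻¹) = iota γ := by
  induction γ using Matrix.ProjGenLinGroup.induction_on with | mk g =>
  induction δ using Matrix.ProjGenLinGroup.induction_on with | mk h =>
  rw [← map_inv, ← map_mul, ← map_mul, iota_mk, iota_mk, iotaGL_conj]

/-- `ι` on conjugacy classes of `PGL₂`. -/
def iotaClass (C : ConjClasses PGL(2, F)) : F :=
  Quotient.liftOn C iota (by
    intro γ γ' h
    obtain ⟨δ, rfl⟩ := isConj_iff.1 h
    exact (iota_conj γ δ).symm)

theorem iotaClass_mk (γ : PGL(2, F)) : iotaClass (ConjClasses.mk γ) = iota γ := rfl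

/-- The set of conjugacy classes of elements of order at least `3` in `PGL₂(F)`, for `F` finite. -/
def classesOrderGeThree (F : Type*) [Field F] : Set (ConjClasses PGL(2, F)) :=
  {C | ∃ γ : PGL(2, F), 3 ≤ orderOf γ ∧ ConjClasses.mk γ = C}

end Finite

end PGL2Artin

/-! Put $D_1=x^q-x$, $D_2=x^{q^2}-x$, and for a matrix over $\mathbb F_q$ with determinant $\Delta$
put $j=cx+d$. Frobenius commutes with $\gamma$, so $\gamma$ multiplies $D_1$ by $\Delta/j^{q+1}$ and
$D_2$ by $\Delta/j^{q^2+1}$. In $Q=D_2^{q+1}/D_1^{q^2+1}$ these factors cancel. Since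
$D_2=D_1(D_1^{q-1}+1)$, the reduced form is $(D_1^{q-1}+1)^{q+1}/D_1^{q(q-1)}$, whose numerator has
degree $q(q-1)(q+1)=|G|$.

The poles of $Q$ are $\mathbb F_q\cup\{\infty\}$ and its zeros are $\mathbb F_{q^2}\setminus\mathbb
F_q$, both too few to be regular fibres. For $\tau\ne0$ the fibre polynomial is separable
(`separable_fibrePoly`), so the fibre has $|G|$ points. A nontrivial $\gamma$ fixes only points at
most quadratic over $\mathbb F_q$, so $G$ acts freely, hence transitively by counting
(`exists_smul_eq`). Frobenius preserves the fibre over $\tau\in\mathbb F_q^\times$, which gives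
$\gamma$ with $v^q=\gamma(v)$.

The link with $\iota$ is the computation $v^q=\gamma(v)\Rightarrow Q(v)=\iota(\gamma)$
(`quotientFun_eq_of_pow_natCard_eq`). On the group side, $\gamma^2=1$ exactly when $\gamma=1$ or the
trace vanishes. A non-scalar matrix of nonzero trace can be rescaled so that trace and determinant
both equal $\iota(\gamma)$, and is then conjugate to a companion matrix depending only on
$\iota(\gamma)$ (`isConj_mk_companion`). Thus $\iota$ classifies the classes of order at least 3,
and this injectivity also makes the Artin invariant independent of choices. -/

namespace PGL2Artin

open Matrix OnePoint

/-! ### Frobenius identities over $\mathbb F_q$, invariance of $Q$, and $Q(v)=\iota(\gamma)$ -/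

section FrobeniusPower

theorem pow_natCard_sq {F M : Type*} [Monoid M] (x : M) :
    x ^ Nat.card F ^ 2 = (x ^ Nat.card F) ^ Nat.card F := by
  rw [sq, pow_mul]

variable {F : Type*} [Field F] [Finite F]

theorem two_le_natCard : 2 ≤ Nat.card F := Finite.one_lt_card

section Ring

variable {R : Type*} [CommRing R] [Algebra F R]

theorem add_pow_natCard (x y : R) :
    (x + y) ^ Nat.card F = x ^ Nat.card F + y ^ Nat.card F := by
  let _ := Fintype.ofFinite F
  rw [Nat.card_eq_fintype_card]
  exact map_add (FiniteField.frobeniusAlgHom F R) x y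

theorem sub_pow_natCard (x y : R) :
    (x - y) ^ Nat.card F = x ^ Nat.card F - y ^ Nat.card F := by
  let _ := Fintype.ofFinite F
  rw [Nat.card_eq_fintype_card]
  exact map_sub (FiniteField.frobeniusAlgHom F R) x y

theorem algebraMap_pow_natCard (a : F) :
    algebraMap F R a ^ Nat.card F = algebraMap F R a := by
  let _ := Fintype.ofFinite F
  rw [Nat.card_eq_fintype_card]
  exact (FiniteField.frobeniusAlgHom F R).commutes a

theorem algebraMap_pow_natCard_sq (a : F) :
    algebraMap F R a ^ Nat.card F ^ 2 = algebraMap F R a := by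
  rw [sq, pow_mul, algebraMap_pow_natCard, algebraMap_pow_natCard]

variable (F) in
theorem natCast_natCard_eq_zero : (Nat.card F : R) = 0 := by
  let _ := Fintype.ofFinite F
  rw [Nat.card_eq_fintype_card, ← map_natCast (algebraMap F R), FiniteField.cast_card_eq_zero,
    map_zero]

variable (F) in
theorem pow_natCard_sq_sub (x : R) :
    x ^ Nat.card F ^ 2 - x =
      (x ^ Nat.card F - x) * ((x ^ Nat.card F - x) ^ (Nat.card F - 1) + 1) := by
  have h := two_le_natCard (F := F)
  have e : (x ^ Nat.card F - x) * (x ^ Nat.card F - x) ^ (Nat.card F - 1) =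
      (x ^ Nat.card F - x) ^ Nat.card F := by
    rw [← pow_succ']
    congr 1
    omega
  rw [mul_add, e, pow_natCard_sq, sub_pow_natCard]
  ring

end Ring

variable {E : Type*} [Field E] [Algebra F E]

variable (F) in
/-- The function `x ↦ (x^(q²) - x)^(q+1) / (x^q - x)^(q²+1)` on a field containing `𝔽_q`. -/
noncomputable def quotientFun (x : E) : E :=
  (x ^ (Nat.card F ^ 2) - x) ^ (Nat.card F + 1) / (x ^ Nat.card F - x) ^ (Nat.card F ^ 2 + 1)

theorem mobius_pow_natCard (a b c d : F) (x : E) :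
    ((algebraMap F E a * x + algebraMap F E b) / (algebraMap F E c * x + algebraMap F E d)) ^
        Nat.card F =
      (algebraMap F E a * x ^ Nat.card F + algebraMap F E b) /
        (algebraMap F E c * x ^ Nat.card F + algebraMap F E d) := by
  simp only [div_pow, add_pow_natCard, mul_pow, algebraMap_pow_natCard]

/-- The effect of a Möbius transformation on differences. -/
theorem mobius_sub_mobius {a b c d x y : E} (hx : c * x + d ≠ 0) (hy : c * y + d ≠ 0) :
    (a * y + b) / (c * y + d) - (a * x + b) / (c * x + d) =
      (a * d - b * c) * (y - x) / ((c * x + d) * (c * y + d)) := by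
  rw [div_sub_div _ _ hy hx]
  congr 1 <;> ring

theorem linear_pow_natCard (c d : F) (x : E) :
    (algebraMap F E c * x + algebraMap F E d) ^ Nat.card F =
      algebraMap F E c * x ^ Nat.card F + algebraMap F E d := by
  simp only [add_pow_natCard, mul_pow, algebraMap_pow_natCard]

/-- The coefficients lie in $\mathbb F_q$, so this is `mobius_sub_mobius` with $y=x^q$, where the
second denominator is $(cx+d)^q$. -/
theorem mobius_pow_natCard_sub {a b c d : F} {x : E}
    (hx : algebraMap F E c * x + algebraMap F E d ≠ 0) :
    ((algebraMap F E a * x + algebraMap F E b) / (algebraMap F E c * x + algebraMap F E d)) ^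
        Nat.card F -
      (algebraMap F E a * x + algebraMap F E b) / (algebraMap F E c * x + algebraMap F E d) =
      algebraMap F E (a * d - b * c) * (x ^ Nat.card F - x) /
        (algebraMap F E c * x + algebraMap F E d) ^ (Nat.card F + 1) := by
  have h1 : algebraMap F E c * x ^ Nat.card F + algebraMap F E d ≠ 0 := by
    rw [← linear_pow_natCard]
    exact pow_ne_zero _ hx
  rw [mobius_pow_natCard, mobius_sub_mobius hx h1, pow_succ', linear_pow_natCard]
  simp

theorem mobius_pow_natCard_sq_sub {a b c d : F} {x : E}
    (hx : algebraMap F E c * x + algebraMap F E d ≠ 0) :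
    ((algebraMap F E a * x + algebraMap F E b) / (algebraMap F E c * x + algebraMap F E d)) ^
        Nat.card F ^ 2 -
      (algebraMap F E a * x + algebraMap F E b) / (algebraMap F E c * x + algebraMap F E d) =
      algebraMap F E (a * d - b * c) * (x ^ Nat.card F ^ 2 - x) /
        (algebraMap F E c * x + algebraMap F E d) ^ (Nat.card F ^ 2 + 1) := by
  have e : (algebraMap F E c * x + algebraMap F E d) ^ Nat.card F ^ 2 =
      algebraMap F E c * x ^ Nat.card F ^ 2 + algebraMap F E d := by
    simp only [sq, pow_mul, linear_pow_natCard]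
  have h2 : algebraMap F E c * x ^ Nat.card F ^ 2 + algebraMap F E d ≠ 0 := by
    rw [← e]
    exact pow_ne_zero _ hx
  have e2 := mobius_sub_mobius (a := algebraMap F E a) (b := algebraMap F E b) hx h2
  rw [pow_succ' _ (Nat.card F ^ 2), e]
  simp only [pow_natCard_sq, mobius_pow_natCard] at e2 ⊢
  rw [e2]
  simp

/-- Numerator and denominator both acquire $(cx+d)^{-(q+1)(q^2+1)}$, and the determinant factors
agree because $\Delta^{q+1}=\Delta^2=\Delta^{q^2+1}$ for $\Delta\in\mathbb F_q$. -/
theorem quotientFun_mobius {a b c d : F} (hdet : a * d - b * c ≠ 0) {x : E}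
    (hx : algebraMap F E c * x + algebraMap F E d ≠ 0) :
    quotientFun F ((algebraMap F E a * x + algebraMap F E b) /
      (algebraMap F E c * x + algebraMap F E d)) = quotientFun F x := by
  have hD : algebraMap F E (a * d - b * c) ≠ 0 := (map_ne_zero _).2 hdet
  rw [quotientFun, mobius_pow_natCard_sub hx, mobius_pow_natCard_sq_sub hx, quotientFun]
  rw [div_pow, div_pow, mul_pow, mul_pow, ← pow_mul, ← pow_mul,
    mul_comm (Nat.card F + 1) (Nat.card F ^ 2 + 1), div_div_div_cancel_right₀ (pow_ne_zero _ hx),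
    pow_succ (algebraMap F E _) (Nat.card F), pow_succ (algebraMap F E _) (Nat.card F ^ 2),
    algebraMap_pow_natCard, algebraMap_pow_natCard_sq,
    mul_div_mul_left _ _ (mul_ne_zero hD hD)]

/-- If `v ^ q = γ(v)` then `Q(v) = ι(γ)`. -/
theorem quotientFun_eq_of_pow_natCard_eq {a b c d : F} (hdet : a * d - b * c ≠ 0) {v : E}
    (hv : v ^ Nat.card F ≠ v) (hx : algebraMap F E c * v + algebraMap F E d ≠ 0)
    (h : v ^ Nat.card F = (algebraMap F E a * v + algebraMap F E b) /
      (algebraMap F E c * v + algebraMap F E d)) :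
    quotientFun F v = algebraMap F E ((a + d) ^ 2 / (a * d - b * c)) := by
  set A := algebraMap F E a
  set B := algebraMap F E b
  set C := algebraMap F E c
  set D := algebraMap F E d
  have hΔ : A * D - B * C ≠ 0 := by
    simpa only [map_sub, map_mul] using (map_ne_zero (algebraMap F E)).2 hdet
  have hT : (A + D) ^ Nat.card F = A + D := by
    simpa only [map_add] using algebraMap_pow_natCard (R := E) (a + d)
  have hΔq : (A * D - B * C) ^ Nat.card F = A * D - B * C := by
    simpa only [map_sub, map_mul] using algebraMap_pow_natCard (R := E) (a * d - b * c)
  have he : (C * v + D) ^ Nat.card F = C * v ^ Nat.card F + D := linear_pow_natCard c d v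
  have hz : v ^ Nat.card F ^ 2 * (C * v + D) ^ Nat.card F = A * v ^ Nat.card F + B := by
    have h' := linear_pow_natCard a b v
    rw [(div_eq_iff hx).1 h.symm, mul_pow, ← pow_natCard_sq] at h'
    exact h'
  have hw : v ^ Nat.card F * (C * v + D) = A * v + B := ((div_eq_iff hx).1 h.symm).symm
  -- The relations `hw` and its Frobenius conjugate `hz` express $v^q$ and $v^{q^2}$ through
  -- $\gamma$; the trace appears in `h1` and the determinant in `h2`.
  have h1 : (v ^ Nat.card F ^ 2 - v) * (C * v + D) ^ Nat.card F =
      (A + D) * (v ^ Nat.card F - v) := by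
    rw [sub_mul, hz, he]
    linear_combination (-1) * hw
  have h2 : (v ^ Nat.card F - v) ^ Nat.card F * (C * v + D) ^ (Nat.card F + 1) =
      (A * D - B * C) * (v ^ Nat.card F - v) := by
    rw [sub_pow_natCard, ← pow_natCard_sq, pow_succ (C * v + D), ← mul_assoc, sub_mul, hz, he]
    linear_combination (-(C * v ^ Nat.card F + D)) * hw
  -- The powers $q+1$ and $q$ are chosen so that both relations contain the same factor
  -- $(Cv+D)^{q(q+1)}$, which is cancelled below.
  have h1' := congrArg (· ^ (Nat.card F + 1)) h1
  have h2' := congrArg (· ^ Nat.card F) h2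
  simp only [mul_pow, hΔq] at h1' h2'
  rw [pow_succ (A + D), hT] at h1'
  simp only [← pow_mul] at h1' h2'
  rw [quotientFun, map_div₀, map_pow, map_add, map_sub, map_mul, map_mul,
    div_eq_div_iff (pow_ne_zero _ (sub_ne_zero.2 hv)) hΔ]
  apply mul_right_cancel₀ (pow_ne_zero (Nat.card F * (Nat.card F + 1)) hx)
  rw [mul_comm (Nat.card F + 1)] at h2'
  rw [← sq] at h2'
  rw [pow_succ _ (Nat.card F ^ 2)]
  linear_combination (A * D - B * C) * h1' - (A + D) ^ 2 * (v ^ Nat.card F - v) * h2'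

/-- Subtracting $cv+d=0$ from its Frobenius conjugate leaves $c(v^q-v)=0$. -/
theorem linear_ne_zero {c d : F} (hcd : c ≠ 0 ∨ d ≠ 0) {v : E} (hv : v ^ Nat.card F ≠ v) :
    algebraMap F E c * v + algebraMap F E d ≠ 0 := by
  intro h
  have h' := linear_pow_natCard c d v
  rw [h, zero_pow Nat.card_pos.ne'] at h'
  have h3 : algebraMap F E c * (v ^ Nat.card F - v) = 0 := by linear_combination (-1) * h' - h
  have hc : algebraMap F E c = 0 := (mul_eq_zero.1 h3).resolve_right (sub_ne_zero.2 hv)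
  rw [hc, zero_mul, zero_add] at h
  simp only [map_eq_zero] at hc h
  tauto

/-- A fixed point of a Möbius transformation over `𝔽_q` is quadratic over `𝔽_q`. -/
theorem eq_zero_of_quadratic {a b c : F} {v : E} (hv : v ^ Nat.card F ≠ v)
    (hv2 : v ^ Nat.card F ^ 2 ≠ v)
    (h : algebraMap F E a * v ^ 2 + algebraMap F E b * v + algebraMap F E c = 0) :
    a = 0 ∧ b = 0 ∧ c = 0 := by
  have key : ∀ x : E, algebraMap F E a * x ^ 2 + algebraMap F E b * x + algebraMap F E c = 0 →
      algebraMap F E a * (x ^ Nat.card F) ^ 2 + algebraMap F E b * x ^ Nat.card F +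
        algebraMap F E c = 0 := by
    intro x hx
    have := congrArg (· ^ Nat.card F) hx
    simp only [add_pow_natCard, mul_pow, algebraMap_pow_natCard, zero_pow (Nat.card_pos (α := F)).ne',
      ← pow_mul] at this
    rw [← this, ← pow_mul, mul_comm (Nat.card F)]
  -- The quadratic vanishes at $v$, $v^q$, $v^{q^2}$, which are pairwise distinct; its first and
  -- second divided differences force the coefficients to be zero.
  have hw := key _ h
  have hz := key _ hw
  rw [← pow_natCard_sq] at hz
  have hne : v ^ Nat.card F ^ 2 ≠ v ^ Nat.card F := by
    intro h0
    apply hv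
    rw [← sub_eq_zero]
    apply pow_eq_zero_iff (Nat.card_pos (α := F)).ne' |>.1
    rw [sub_pow_natCard, ← pow_natCard_sq, h0, sub_self]
  have e1 : algebraMap F E a * (v ^ Nat.card F + v) + algebraMap F E b = 0 := by
    apply mul_left_cancel₀ (sub_ne_zero.2 hv)
    linear_combination hw - h
  have e2 : algebraMap F E a * (v ^ Nat.card F ^ 2 + v ^ Nat.card F) + algebraMap F E b = 0 := by
    apply mul_left_cancel₀ (sub_ne_zero.2 hne)
    linear_combination hz - hw
  have ha : algebraMap F E a = 0 := by
    apply mul_left_cancel₀ (sub_ne_zero.2 hv2)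
    linear_combination e2 - e1
  rw [ha, zero_mul, zero_add] at e1
  rw [ha, e1, zero_mul, zero_mul, zero_add, zero_add] at h
  simp only [map_eq_zero] at ha e1 h
  exact ⟨ha, e1, h⟩

end FrobeniusPower

/-! ### Lowest terms of $Q$ and the sizes of its fibres -/

section QuotientMap

theorem quotientFun_eq {F E : Type*} [Field F] [Finite F] [Field E] [Algebra F E] {x : E}
    (hx : x ^ Nat.card F ≠ x) :
    quotientFun F x = ((x ^ Nat.card F - x) ^ (Nat.card F - 1) + 1) ^ (Nat.card F + 1) /
      (x ^ Nat.card F - x) ^ (Nat.card F * (Nat.card F - 1)) := by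
  have e : Nat.card F ^ 2 + 1 = (Nat.card F + 1) + Nat.card F * (Nat.card F - 1) := by
    have := two_le_natCard (F := F)
    obtain ⟨n, hn⟩ : ∃ n, Nat.card F = n + 1 := ⟨Nat.card F - 1, by omega⟩
    rw [hn, Nat.add_sub_cancel]
    ring
  rw [quotientFun, pow_natCard_sq_sub F x, e, pow_add _ (Nat.card F + 1), mul_pow,
    mul_div_mul_left _ _ (pow_ne_zero _ (sub_ne_zero.2 hx))]

section Value

variable {K L : Type*} [Field K] [Field L] [Algebra K L] (Q : RatFunc K)

open scoped Classical in
theorem value_coe (v : L) :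
    value Q (v : OnePoint L) =
      if Polynomial.aeval v Q.denom = 0 then ∞
      else ((Polynomial.aeval v Q.num / Polynomial.aeval v Q.denom : L) : OnePoint L) := rfl

theorem value_infty_of_natDegree_lt (h : Q.denom.natDegree < Q.num.natDegree) :
    value Q (∞ : OnePoint L) = ∞ := by
  refine if_pos ?_
  rw [max_eq_left h.le]
  exact Polynomial.coeff_eq_zero_of_natDegree_lt h

end Value

open Polynomial

variable (F : Type*) [Field F] [Finite F] (E : Type*) [Field E]

/-- The numerator `((x^q - x)^(q-1) + 1)^(q+1)` of the quotient map. -/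
noncomputable def numPoly : E[X] :=
  ((X ^ Nat.card F - X) ^ (Nat.card F - 1) + 1) ^ (Nat.card F + 1)

/-- The denominator `(x^q - x)^(q(q-1))` of the quotient map. -/
noncomputable def denomPoly : E[X] :=
  (X ^ Nat.card F - X) ^ (Nat.card F * (Nat.card F - 1))

theorem monic_X_pow_natCard_sub_X : (X ^ Nat.card F - X : E[X]).Monic :=
  monic_X_pow_sub ((degree_X_le).trans_lt (by exact_mod_cast two_le_natCard (F := F)))

theorem natDegree_X_pow_natCard_sub_X : (X ^ Nat.card F - X : E[X]).natDegree = Nat.card F :=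
  FiniteField.X_pow_card_sub_X_natDegree_eq E two_le_natCard

theorem natDegree_X_pow_natCard_sub_X_pow :
    ((X ^ Nat.card F - X : E[X]) ^ (Nat.card F - 1)).natDegree =
      Nat.card F * (Nat.card F - 1) := by
  rw [natDegree_pow, natDegree_X_pow_natCard_sub_X, mul_comm]

theorem natCard_mul_pos : 0 < Nat.card F * (Nat.card F - 1) := by
  have := two_le_natCard (F := F)
  exact Nat.mul_pos (by omega) (by omega)

theorem natDegree_numPoly :
    (numPoly F E).natDegree = Nat.card F * (Nat.card F - 1) * (Nat.card F + 1) := by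
  rw [numPoly, natDegree_pow, natDegree_add_eq_left_of_natDegree_lt,
    natDegree_X_pow_natCard_sub_X_pow, mul_comm]
  rw [natDegree_X_pow_natCard_sub_X_pow, natDegree_one]
  exact natCard_mul_pos F

theorem natDegree_denomPoly :
    (denomPoly F E).natDegree = Nat.card F * (Nat.card F - 1) * Nat.card F := by
  rw [denomPoly, natDegree_pow, natDegree_X_pow_natCard_sub_X]

theorem natDegree_denomPoly_lt : (denomPoly F E).natDegree < (numPoly F E).natDegree := by
  rw [natDegree_numPoly, natDegree_denomPoly]
  exact Nat.mul_lt_mul_of_pos_left (Nat.lt_succ_self _) (natCard_mul_pos F)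

theorem monic_denomPoly : (denomPoly F E).Monic := (monic_X_pow_natCard_sub_X F E).pow _

theorem isCoprime_pow_add_one :
    IsCoprime ((X ^ Nat.card F - X : E[X]) ^ (Nat.card F - 1) + 1) (X ^ Nat.card F - X) := by
  have := two_le_natCard (F := F)
  obtain ⟨n, hn⟩ : ∃ n, Nat.card F - 1 = n + 1 := ⟨Nat.card F - 2, by omega⟩
  refine ⟨1, -(X ^ Nat.card F - X) ^ n, ?_⟩
  rw [hn]
  ring

theorem isCoprime_numPoly_denomPoly : IsCoprime (numPoly F E) (denomPoly F E) :=
  (isCoprime_pow_add_one F E).pow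

-- The extension field may be $\mathbb F_q(x)$ itself: identities for `quotientFun` at the generic
-- point are identities of rational functions.
omit [Finite F] in
theorem quotientMap_eq_quotientFun : quotientMap F = quotientFun F (RatFunc.X : RatFunc F) := rfl

theorem ratFunc_X_pow_natCard_ne : (RatFunc.X : RatFunc F) ^ Nat.card F ≠ RatFunc.X := by
  rw [← sub_ne_zero, ← RatFunc.algebraMap_X, ← map_pow, ← map_sub]
  exact RatFunc.algebraMap_ne_zero (monic_X_pow_natCard_sub_X F F).ne_zero

theorem quotientMap_eq :
    quotientMap F = algebraMap F[X] (RatFunc F) (numPoly F F) /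
      algebraMap F[X] (RatFunc F) (denomPoly F F) := by
  rw [quotientMap_eq_quotientFun, quotientFun_eq (ratFunc_X_pow_natCard_ne F)]
  simp [numPoly, denomPoly]

/-- Two coprime representations of one fraction have associated denominators, and both denominators
here are monic. -/
theorem num_quotientMap_and_denom :
    (quotientMap F).num = numPoly F F ∧ (quotientMap F).denom = denomPoly F F := by
  have hd := (monic_denomPoly F F).ne_zero
  have h : (quotientMap F).num * denomPoly F F = numPoly F F * (quotientMap F).denom := by
    rw [RatFunc.num_mul_eq_mul_denom_iff hd, quotientMap_eq]
  have hden : (quotientMap F).denom = denomPoly F F := by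
    refine eq_of_monic_of_associated (RatFunc.monic_denom _) (monic_denomPoly F F)
      (associated_of_dvd_dvd ?_ ?_)
    · refine (RatFunc.isCoprime_num_denom (quotientMap F)).symm.dvd_of_dvd_mul_left ?_
      rw [h]
      exact dvd_mul_left _ _
    · refine (isCoprime_numPoly_denomPoly F F).symm.dvd_of_dvd_mul_left ?_
      rw [← h]
      exact dvd_mul_left _ _
  refine ⟨mul_right_cancel₀ hd ?_, hden⟩
  rw [h, hden]

theorem num_quotientMap : (quotientMap F).num = numPoly F F := (num_quotientMap_and_denom F).1

theorem denom_quotientMap : (quotientMap F).denom = denomPoly F F :=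
  (num_quotientMap_and_denom F).2

variable [Algebra F E]

omit [Finite F] in
theorem map_numPoly : (numPoly F F).map (algebraMap F E) = numPoly F E := by
  simp [numPoly]

omit [Finite F] in
theorem map_denomPoly : (denomPoly F F).map (algebraMap F E) = denomPoly F E := by
  simp [denomPoly]

variable {E}

omit [Finite F] in
theorem aeval_numPoly (x : E) :
    aeval x (numPoly F F) =
      ((x ^ Nat.card F - x) ^ (Nat.card F - 1) + 1) ^ (Nat.card F + 1) := by
  simp [numPoly]

omit [Finite F] in
theorem aeval_denomPoly (x : E) :
    aeval x (denomPoly F F) = (x ^ Nat.card F - x) ^ (Nat.card F * (Nat.card F - 1)) := by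
  simp [denomPoly]

theorem aeval_denomPoly_eq_zero_iff {x : E} :
    aeval x (denomPoly F F) = 0 ↔ x ^ Nat.card F = x := by
  rw [aeval_denomPoly, pow_eq_zero_iff (natCard_mul_pos F).ne', sub_eq_zero]

theorem aeval_numPoly_div_aeval_denomPoly {x : E} (hx : x ^ Nat.card F ≠ x) :
    aeval x (numPoly F F) / aeval x (denomPoly F F) = quotientFun F x := by
  rw [quotientFun_eq hx, aeval_numPoly, aeval_denomPoly]

theorem eval_mobius_quotientMap (g : GL (Fin 2) F) :
    RatFunc.eval RatFunc.C (mobius g) (quotientMap F) = quotientMap F := by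
  have hdet : g 0 0 * g 1 1 - g 0 1 * g 1 0 ≠ 0 := by
    rw [← Matrix.det_fin_two]
    exact g.det.ne_zero
  have hcd : g 1 0 ≠ 0 ∨ g 1 1 ≠ 0 := by
    by_contra! h
    simp [h.1, h.2] at hdet
  have hX := ratFunc_X_pow_natCard_ne F
  have hx := linear_ne_zero hcd hX
  -- The reduced form may be replaced by `quotientFun` only off the zeros of its denominator, so
  -- $\gamma(x)$ must not be fixed by the $q$-th power map.
  have hm : mobius g ^ Nat.card F ≠ mobius g := by
    rw [← sub_ne_zero]
    refine (mobius_pow_natCard_sub (a := g 0 0) (b := g 0 1) hx).trans_ne ?_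
    exact div_ne_zero (mul_ne_zero ((_root_.map_ne_zero _).2 hdet) (sub_ne_zero.2 hX))
      (pow_ne_zero _ hx)
  rw [RatFunc.eval, num_quotientMap, denom_quotientMap]
  refine (aeval_numPoly_div_aeval_denomPoly F hm).trans ?_
  exact quotientFun_mobius hdet hx

theorem value_quotientMap_coe {v : E} (hv : v ^ Nat.card F ≠ v) :
    value (quotientMap F) (v : OnePoint E) = ((quotientFun F v : E) : OnePoint E) := by
  rw [value_coe, num_quotientMap, denom_quotientMap,
    if_neg (mt (aeval_denomPoly_eq_zero_iff F).1 hv), aeval_numPoly_div_aeval_denomPoly F hv]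

theorem value_quotientMap_coe_of_eq {v : E} (hv : v ^ Nat.card F = v) :
    value (quotientMap F) (v : OnePoint E) = ∞ := by
  rw [value_coe, denom_quotientMap, if_pos ((aeval_denomPoly_eq_zero_iff F).2 hv)]

theorem value_quotientMap_infty : value (quotientMap F) (∞ : OnePoint E) = ∞ := by
  apply value_infty_of_natDegree_lt
  rw [num_quotientMap, denom_quotientMap]
  exact natDegree_denomPoly_lt F F

theorem pow_natCard_ne_of_value_eq_coe {v τ : E}
    (h : value (quotientMap F) (v : OnePoint E) = (τ : OnePoint E)) : v ^ Nat.card F ≠ v := by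
  intro hv
  rw [value_quotientMap_coe_of_eq F hv] at h
  exact OnePoint.infty_ne_coe _ h

theorem quotientFun_eq_of_value_eq_coe {v τ : E}
    (h : value (quotientMap F) (v : OnePoint E) = (τ : OnePoint E)) : quotientFun F v = τ := by
  rw [value_quotientMap_coe F (pow_natCard_ne_of_value_eq_coe F h)] at h
  exact OnePoint.coe_injective h

omit [Field F] [Finite F] [Algebra F E] in
theorem quotientFun_eq_zero_iff {v : E} (hv : v ^ Nat.card F ≠ v) :
    quotientFun F v = 0 ↔ v ^ Nat.card F ^ 2 = v := by
  rw [quotientFun, div_eq_zero_iff, or_iff_left (pow_ne_zero _ (sub_ne_zero.2 hv)),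
    pow_eq_zero_iff (Nat.succ_ne_zero _), sub_eq_zero]

/-- The polynomial whose roots form the fibre of the quotient map over `τ`. -/
noncomputable def fibrePoly (τ : E) : E[X] := numPoly F E - C τ * denomPoly F E

omit [Algebra F E] in
theorem natDegree_fibrePoly (τ : E) :
    (fibrePoly F τ).natDegree = Nat.card F * (Nat.card F - 1) * (Nat.card F + 1) := by
  rw [fibrePoly, natDegree_sub_eq_left_of_natDegree_lt, natDegree_numPoly]
  exact (natDegree_C_mul_le _ _).trans_lt (natDegree_denomPoly_lt F E)

omit [Algebra F E] in
theorem fibrePoly_ne_zero (τ : E) : fibrePoly F τ ≠ 0 := by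
  intro h
  have := natDegree_fibrePoly F τ
  rw [h, natDegree_zero] at this
  exact (Nat.mul_pos (natCard_mul_pos F) (Nat.succ_pos _)).ne this

omit [Finite F] in
theorem eval_fibrePoly (τ v : E) :
    (fibrePoly F τ).eval v = aeval v (numPoly F F) - τ * aeval v (denomPoly F F) := by
  rw [fibrePoly, eval_sub, eval_mul, eval_C, ← map_numPoly, ← map_denomPoly, eval_map_algebraMap,
    eval_map_algebraMap]

theorem eval_fibrePoly_eq_zero_iff {τ v : E} :
    (fibrePoly F τ).eval v = 0 ↔
      value (quotientMap F) (v : OnePoint E) = (τ : OnePoint E) := by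
  rw [eval_fibrePoly]
  by_cases hv : v ^ Nat.card F = v
  -- At a point of $\mathbb F_q$ the denominator is 0 and the numerator is 1, so such a point is
  -- neither a root nor in the fibre.
  · rw [value_quotientMap_coe_of_eq F hv, (aeval_denomPoly_eq_zero_iff F).2 hv, aeval_numPoly, hv,
      sub_self, zero_pow (by have := two_le_natCard (F := F); omega)]
    simp
  · rw [value_quotientMap_coe F hv, ← aeval_numPoly_div_aeval_denomPoly F hv, OnePoint.coe_eq_coe,
      div_eq_iff (mt (aeval_denomPoly_eq_zero_iff F).1 hv), sub_eq_zero]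

theorem derivative_X_pow_natCard_sub_X : derivative (X ^ Nat.card F - X : E[X]) = -1 := by
  rw [derivative_sub, derivative_X_pow, natCast_natCard_eq_zero F, C_0, zero_mul, derivative_X,
    zero_sub]

/-- The exponent $q(q-1)$ is zero in $E$, so the term with $\tau$ disappears; the factors $q-1=-1$
and $D_1'=-1$ cancel in sign. -/
theorem derivative_fibrePoly (τ : E) :
    derivative (fibrePoly F τ) =
      ((X ^ Nat.card F - X) ^ (Nat.card F - 1) + 1) ^ Nat.card F *
        (X ^ Nat.card F - X) ^ (Nat.card F - 2) := by
  have h2 := two_le_natCard (F := F)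
  have hq : C ((Nat.card F : ℕ) : E) = 0 := by rw [natCast_natCard_eq_zero F, C_0]
  have hq1 : C ((Nat.card F - 1 : ℕ) : E) = -1 := by
    rw [Nat.cast_sub (by omega), natCast_natCard_eq_zero F]
    simp
  rw [fibrePoly, derivative_sub, derivative_C_mul, numPoly, denomPoly, derivative_pow,
    derivative_pow, derivative_add, derivative_pow, derivative_X_pow_natCard_sub_X, hq1,
    Nat.cast_add, Nat.cast_mul, C_add, C_mul, hq]
  simp [Nat.sub_sub]

/-- Each factor of the derivative is coprime to the fibre polynomial: modulo $D_1^{q-1}+1$ the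
latter is $-\tau D_1^{q(q-1)}$, a unit because $\tau\ne0$, and modulo $D_1$ it is a power of
$D_1^{q-1}+1\equiv1$. -/
theorem separable_fibrePoly {τ : E} (hτ : τ ≠ 0) : (fibrePoly F τ).Separable := by
  rw [Polynomial.Separable, derivative_fibrePoly]
  obtain ⟨n, hn⟩ : ∃ n, Nat.card F * (Nat.card F - 1) = n + 1 :=
    ⟨_, (Nat.succ_pred (natCard_mul_pos F).ne').symm⟩
  refine IsCoprime.mul_right (IsCoprime.pow_right ?_) (IsCoprime.pow_right ?_)
  · rw [fibrePoly, numPoly, denomPoly, pow_succ', sub_eq_add_neg, add_comm]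
    refine IsCoprime.add_mul_left_left ?_ _
    rw [IsCoprime.neg_left_iff]
    refine IsCoprime.mul_left ?_ ((isCoprime_pow_add_one F E).symm.pow_left)
    exact ⟨C τ⁻¹, 0, by rw [← C_mul, inv_mul_cancel₀ hτ, C_1, zero_mul, add_zero]⟩
  · rw [fibrePoly, denomPoly, hn, pow_succ', mul_left_comm, sub_eq_add_neg, ← mul_neg]
    exact IsCoprime.add_mul_left_left (isCoprime_pow_add_one F E).pow_left _

theorem natCard_fibre [IsAlgClosed E] {τ : E} (hτ : τ ≠ 0) :
    Nat.card {w : OnePoint E // value (quotientMap F) w = (τ : OnePoint E)} =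
      Nat.card F * (Nat.card F - 1) * (Nat.card F + 1) := by
  have h1 : {w : OnePoint E | value (quotientMap F) w = (τ : OnePoint E)} =
      (fun v : E ↦ (v : OnePoint E)) '' (fibrePoly F τ).rootSet E := by
    ext w
    induction w using OnePoint.rec with
    | infty => simp [value_quotientMap_infty]
    | coe v => simp [mem_rootSet, fibrePoly_ne_zero, eval_fibrePoly_eq_zero_iff]
  have h2 := card_rootSet_eq_natDegree (K := E) (separable_fibrePoly F hτ)
    (IsAlgClosed.splits _)
  rw [natDegree_fibrePoly, ← Nat.card_eq_fintype_card] at h2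
  rw [← h2]
  change Nat.card ({w : OnePoint E | value (quotientMap F) w = (τ : OnePoint E)} : Set _) = _
  rw [h1]
  exact Nat.card_image_of_injective OnePoint.coe_injective _

theorem ncard_pow_eq_self_le {n : ℕ} (hn : 1 < n) : {v : E | v ^ n = v}.ncard ≤ n := by
  classical
  have h0 := FiniteField.X_pow_card_sub_X_ne_zero E hn
  have h : {v : E | v ^ n = v} = ((X ^ n - X : E[X]).roots.toFinset : Set E) := by
    ext v
    simp [h0, sub_eq_zero]
  rw [h, Set.ncard_coe_finset]
  exact (Multiset.toFinset_card_le _).trans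
    ((card_roots' _).trans (FiniteField.X_pow_card_sub_X_natDegree_eq E hn).le)

theorem finite_pow_eq_self {n : ℕ} (hn : 1 < n) : {v : E | v ^ n = v}.Finite := by
  classical
  have h0 := FiniteField.X_pow_card_sub_X_ne_zero E hn
  refine (X ^ n - X : E[X]).roots.toFinset.finite_toSet.subset fun v hv ↦ ?_
  simpa [h0, sub_eq_zero] using hv

/-- The polynomial $x^q-x$ has at most $q$ roots, and the image of $\mathbb F_q$ already supplies
$q$ of them. -/
theorem mem_range_of_pow_natCard_eq {v : E} (hv : v ^ Nat.card F = v) :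
    v ∈ Set.range (algebraMap F E) := by
  have hn := two_le_natCard (F := F)
  have h : Set.range (algebraMap F E) ⊆ {v : E | v ^ Nat.card F = v} := by
    rintro _ ⟨a, rfl⟩
    exact algebraMap_pow_natCard a
  rw [Set.eq_of_subset_of_ncard_le h ?_ (finite_pow_eq_self hn)]
  · exact hv
  · rw [← Set.image_univ, Set.ncard_image_of_injective _ (algebraMap F E).injective,
      Set.ncard_univ]
    exact ncard_pow_eq_self_le hn

theorem natCard_fibre_infty_le :
    Nat.card {w : OnePoint E // value (quotientMap F) w = ∞} ≤ Nat.card F + 1 := by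
  have hn := two_le_natCard (F := F)
  have h : {w : OnePoint E | value (quotientMap F) w = ∞} ⊆
      insert ∞ ((fun v : E ↦ (v : OnePoint E)) '' {v : E | v ^ Nat.card F = v}) := by
    intro w hw
    induction w using OnePoint.rec with
    | infty => simp
    | coe v =>
      refine Or.inr ⟨v, ?_, rfl⟩
      by_contra hv
      rw [Set.mem_ofPred_eq, value_quotientMap_coe F hv] at hw
      exact OnePoint.coe_ne_infty _ hw
  have hf := (finite_pow_eq_self (E := E) hn).image (fun v : E ↦ (v : OnePoint E))
  refine (Set.ncard_le_ncard h (hf.insert _)).trans ((Set.ncard_insert_le _ _).trans ?_)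
  rw [Set.ncard_image_of_injective _ OnePoint.coe_injective]
  exact Nat.add_le_add_right (ncard_pow_eq_self_le hn) 1

/-- Zeros of $Q$ satisfy $v^{q^2}=v$. The bound is not sharp, but it is below $|G|$, which is all
that irregularity needs. -/
theorem natCard_fibre_zero_le :
    Nat.card {w : OnePoint E // value (quotientMap F) w = ((0 : E) : OnePoint E)} ≤
      Nat.card F ^ 2 := by
  have hn : 1 < Nat.card F ^ 2 := Nat.one_lt_pow two_ne_zero two_le_natCard
  have h : {w : OnePoint E | value (quotientMap F) w = ((0 : E) : OnePoint E)} ⊆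
      (fun v : E ↦ (v : OnePoint E)) '' {v : E | v ^ Nat.card F ^ 2 = v} := by
    intro w hw
    induction w using OnePoint.rec with
    | infty => simp [value_quotientMap_infty] at hw
    | coe v =>
      refine ⟨v, ?_, rfl⟩
      exact (quotientFun_eq_zero_iff F (pow_natCard_ne_of_value_eq_coe F hw)).1
        (quotientFun_eq_of_value_eq_coe F hw)
  have hf := (finite_pow_eq_self (E := E) hn).image (fun v : E ↦ (v : OnePoint E))
  refine (Set.ncard_le_ncard h hf).trans ?_
  rw [Set.ncard_image_of_injective _ OnePoint.coe_injective]
  exact ncard_pow_eq_self_le hn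

end QuotientMap

/-! ### Conjugacy classes of $\mathrm{PGL}_2(\mathbb F_q)$, the invariant $\iota$, and the group
order -/

section Group

variable {F : Type*} [Field F]

theorem det_ne_zero_fin_two (g : GL (Fin 2) F) : g 0 0 * g 1 1 - g 0 1 * g 1 0 ≠ 0 := by
  rw [← Matrix.det_fin_two]
  exact g.det.ne_zero

theorem mk_eq_one_iff_fin_two {g : GL (Fin 2) F} :
    (ProjGenLinGroup.mk g : PGL(2, F)) = 1 ↔ g 0 1 = 0 ∧ g 1 0 = 0 ∧ g 0 0 = g 1 1 := by
  rw [ProjGenLinGroup.mk_eq_one, GeneralLinearGroup.center_eq_range_scalar]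
  constructor
  · rintro ⟨u, rfl⟩
    simp
  · rintro ⟨h1, h2, h3⟩
    have h0 : g 0 0 ≠ 0 := by
      have := det_ne_zero_fin_two g
      rw [h1, zero_mul, sub_zero] at this
      exact left_ne_zero_of_mul this
    refine ⟨Units.mk0 _ h0, ?_⟩
    ext i j
    fin_cases i <;> fin_cases j <;> simp [h1, h2, h3]

theorem iotaGL_eq_zero_iff {g : GL (Fin 2) F} : iotaGL g = 0 ↔ g 0 0 + g 1 1 = 0 := by
  rw [iotaGL, div_eq_zero_iff, or_iff_left (det_ne_zero_fin_two g), pow_eq_zero_iff two_ne_zero]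

/-- By Cayley–Hamilton $g^2=\mathrm{tr}(g)\,g-\det(g)$, which is scalar exactly when $g$ is scalar
or its trace is zero, in every characteristic. -/
theorem sq_eq_one_iff {γ : PGL(2, F)} : γ ^ 2 = 1 ↔ γ = 1 ∨ iota γ = 0 := by
  induction γ using ProjGenLinGroup.induction_on with | mk g =>
  have h : ∀ i j, (g ^ 2) i j = g i 0 * g 0 j + g i 1 * g 1 j := by
    intro i j
    rw [sq, Units.val_mul, Matrix.mul_apply, Fin.sum_univ_two]
  rw [← map_pow, mk_eq_one_iff_fin_two, mk_eq_one_iff_fin_two, iota_mk, iotaGL_eq_zero_iff]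
  simp only [h]
  constructor
  · rintro ⟨h1, h2, h3⟩
    by_cases ht : g 0 0 + g 1 1 = 0
    · exact Or.inr ht
    · refine Or.inl ⟨?_, ?_, ?_⟩
      · apply mul_left_cancel₀ ht
        linear_combination h1
      · apply mul_left_cancel₀ ht
        linear_combination h2
      · rw [← sub_eq_zero]
        apply mul_left_cancel₀ ht
        linear_combination h3
  · rintro (⟨h1, h2, h3⟩ | ht)
    · simp [h1, h2, h3]
    · refine ⟨?_, ?_, ?_⟩
      · linear_combination g 0 1 * ht
      · linear_combination g 1 0 * ht
      · linear_combination (g 0 0 - g 1 1) * ht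

theorem three_le_orderOf_iff [Finite F] {γ : PGL(2, F)} :
    3 ≤ orderOf γ ↔ γ ≠ 1 ∧ iota γ ≠ 0 := by
  have : Finite PGL(2, F) := Finite.of_surjective _ ProjGenLinGroup.mk_surjective
  have hpos := orderOf_pos γ
  have h1 : orderOf γ = 1 ↔ γ = 1 := orderOf_eq_one_iff
  constructor
  · intro h
    have h2 : ¬ γ ^ 2 = 1 := fun h2 ↦
      absurd (Nat.le_of_dvd two_pos (orderOf_dvd_of_pow_eq_one h2)) (by omega)
    rw [sq_eq_one_iff, not_or] at h2
    exact h2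
  · rintro h
    rw [ne_eq, ne_eq, ← not_or, ← sq_eq_one_iff] at h
    by_contra hlt
    have : orderOf γ = 1 ∨ orderOf γ = 2 := by omega
    apply h
    apply orderOf_dvd_iff_pow_eq_one.1
    rcases this with h | h <;> rw [h]
    exact one_dvd _

/-- The matrix with both trace and determinant equal to `τ`, in rational canonical form. -/
noncomputable def companion {τ : F} (hτ : τ ≠ 0) : GL (Fin 2) F :=
  GeneralLinearGroup.mkOfDetNeZero !![0, -τ; 1, τ] (by simpa [Matrix.det_fin_two] using hτ)

theorem iota_companion {τ : F} (hτ : τ ≠ 0) :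
    iota (ProjGenLinGroup.mk (companion hτ)) = τ := by
  rw [iota_mk, iotaGL]
  simp [companion, GeneralLinearGroup.mkOfDetNeZero]
  field_simp

theorem mk_companion_ne_one {τ : F} (hτ : τ ≠ 0) :
    (ProjGenLinGroup.mk (companion hτ) : PGL(2, F)) ≠ 1 := by
  rw [ne_eq, mk_eq_one_iff_fin_two]
  simp [companion, GeneralLinearGroup.mkOfDetNeZero]

/-- A non-scalar `2 × 2` matrix has a cyclic vector. -/
theorem exists_cyclic_vector {a b c d : F} (h : ¬ (b = 0 ∧ c = 0 ∧ a = d)) :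
    ∃ x y : F, x * (c * x + d * y) - (a * x + b * y) * y ≠ 0 := by
  by_cases hc : c = 0
  · by_cases hb : b = 0
    · refine ⟨1, 1, fun h0 ↦ h ⟨hb, hc, ?_⟩⟩
      linear_combination (-1) * h0 + hc - hb
    · exact ⟨0, 1, by simpa using hb⟩
  · exact ⟨1, 0, by simpa using hc⟩

/-- Rescaling does not change the class in $\mathrm{PGL}_2$, and a non-scalar $2\times2$ matrix is
determined up to conjugacy by its trace and determinant. -/
theorem isConj_mk_companion {γ : PGL(2, F)} (hγ : γ ≠ 1) {τ : F} (hτ : τ ≠ 0)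
    (h : iota γ = τ) : IsConj (ProjGenLinGroup.mk (companion hτ)) γ := by
  induction γ using ProjGenLinGroup.induction_on with | mk g =>
  have hdet := det_ne_zero_fin_two g
  have hnt : g 0 0 + g 1 1 ≠ 0 := by
    rw [ne_eq, ← iotaGL_eq_zero_iff, ← iota_mk, h]
    exact hτ
  rw [iota_mk, iotaGL, div_eq_iff hdet] at h
  obtain ⟨x, y, hxy⟩ := exists_cyclic_vector (mt mk_eq_one_iff_fin_two.2 hγ)
  -- Scaling by $u=\mathrm{tr}/\det$ makes trace and determinant both equal to
  -- $\mathrm{tr}^2/\det=\tau$.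
  set u := (g 0 0 + g 1 1) / (g 0 0 * g 1 1 - g 0 1 * g 1 0) with hu
  have hu0 : u ≠ 0 := div_ne_zero hnt hdet
  have htr : u * (g 0 0 + g 1 1) = τ := by
    rw [hu, div_mul_eq_mul_div, div_eq_iff hdet, ← h]
    ring
  have hud : u * (g 0 0 * g 1 1 - g 0 1 * g 1 0) = g 0 0 + g 1 1 := div_mul_cancel₀ _ hdet
  -- The columns are a cyclic vector $e=(x,y)$ and its image $u\,g\,e$, the basis in which $ug$
  -- becomes the companion matrix.
  let P : GL (Fin 2) F := GeneralLinearGroup.mkOfDetNeZero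
    !![x, u * (g 0 0 * x + g 0 1 * y); y, u * (g 1 0 * x + g 1 1 * y)] (by
      rw [Matrix.det_fin_two_of]
      intro h0
      apply mul_ne_zero hu0 hxy
      linear_combination h0)
  have hP : g * GeneralLinearGroup.scalar (Fin 2) (Units.mk0 u hu0) * P = P * companion hτ := by
    ext i j
    fin_cases i <;> fin_cases j <;>
      simp [P, companion, GeneralLinearGroup.mkOfDetNeZero, Matrix.mul_apply, Fin.sum_univ_two]
    · ring
    · linear_combination u * (g 0 0 * x + g 0 1 * y) * htr - x * u * hud - x * htr
    · ring
    · linear_combination u * (g 1 0 * x + g 1 1 * y) * htr - y * u * hud - y * htr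
  have hP' := congrArg (ProjGenLinGroup.mk (n := Fin 2) (R := F)) hP
  rw [map_mul, map_mul, map_mul, ProjGenLinGroup.mk_scalar, mul_one] at hP'
  exact isConj_iff.2 ⟨ProjGenLinGroup.mk P, by rw [← hP', mul_inv_cancel_right]⟩

theorem iotaClass_companion {τ : F} (hτ : τ ≠ 0) :
    iotaClass (ConjClasses.mk (ProjGenLinGroup.mk (companion hτ))) = τ :=
  iota_companion hτ

variable [Finite F]

theorem companion_mem_classesOrderGeThree {τ : F} (hτ : τ ≠ 0) :
    ConjClasses.mk (ProjGenLinGroup.mk (companion hτ)) ∈ classesOrderGeThree F :=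
  ⟨_, three_le_orderOf_iff.2 ⟨mk_companion_ne_one hτ, by rwa [iota_companion hτ]⟩, rfl⟩

theorem eq_companion_of_mem_classesOrderGeThree {C : ConjClasses PGL(2, F)}
    (hC : C ∈ classesOrderGeThree F) {τ : F} (hτ : τ ≠ 0) (h : iotaClass C = τ) :
    C = ConjClasses.mk (ProjGenLinGroup.mk (companion hτ)) := by
  obtain ⟨γ, hγ, rfl⟩ := hC
  exact (ConjClasses.mk_eq_mk_iff_isConj.2
    (isConj_mk_companion (three_le_orderOf_iff.1 hγ).1 hτ h)).symm

theorem iotaClass_ne_zero {C : ConjClasses PGL(2, F)} (hC : C ∈ classesOrderGeThree F) :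
    iotaClass C ≠ 0 := by
  obtain ⟨γ, hγ, rfl⟩ := hC
  exact (three_le_orderOf_iff.1 hγ).2

theorem bijOn_iotaClass : Set.BijOn iotaClass (classesOrderGeThree F) {τ : F | τ ≠ 0} := by
  refine ⟨fun C hC ↦ iotaClass_ne_zero hC, fun C hC C' hC' h ↦ ?_, fun τ hτ ↦
    ⟨_, companion_mem_classesOrderGeThree hτ, iotaClass_companion hτ⟩⟩
  rw [eq_companion_of_mem_classesOrderGeThree hC (iotaClass_ne_zero hC') h,
    ← eq_companion_of_mem_classesOrderGeThree hC' (iotaClass_ne_zero hC') rfl]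

theorem natCard_PGL :
    Nat.card PGL(2, F) = Nat.card F * (Nat.card F - 1) * (Nat.card F + 1) := by
  have hq := two_le_natCard (F := F)
  -- Writing $q=n+2$ removes the truncated subtractions.
  obtain ⟨n, hn⟩ : ∃ n, Nat.card F = n + 2 := ⟨Nat.card F - 2, by omega⟩
  have h1 : Nat.card (GL (Fin 2) F) = (Nat.card F ^ 2 - 1) * (Nat.card F ^ 2 - Nat.card F) := by
    let _ := Fintype.ofFinite F
    rw [Matrix.card_GL_field, Fin.prod_univ_two, Nat.card_eq_fintype_card]
    simp
  have h2 : Nat.card (GL (Fin 2) F) =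
      Nat.card PGL(2, F) * Nat.card (Subgroup.center (GL (Fin 2) F)) :=
    Subgroup.card_eq_card_quotient_mul_card_subgroup _
  have hinj : Function.Injective (GeneralLinearGroup.scalar (Fin 2) : Fˣ →* GL (Fin 2) F) := by
    intro u v huv
    have := congrArg (fun g : GL (Fin 2) F ↦ g 0 0) huv
    simpa [Units.ext_iff] using this
  have h3 : Nat.card (Subgroup.center (GL (Fin 2) F)) = Nat.card F - 1 := by
    rw [GeneralLinearGroup.center_eq_range_scalar, ← Nat.card_units F]
    exact (Nat.card_congr (MonoidHom.ofInjective hinj).toEquiv).symm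
  rw [h1, h3, hn] at h2
  rw [hn]
  have e1 : (n + 2) ^ 2 - 1 = (n + 1) * (n + 3) := by
    rw [show (n + 2) ^ 2 = (n + 1) * (n + 3) + 1 by ring, Nat.add_sub_cancel]
  have e2 : (n + 2) ^ 2 - (n + 2) = (n + 2) * (n + 1) := by
    rw [show (n + 2) ^ 2 = (n + 2) * (n + 1) + (n + 2) by ring, Nat.add_sub_cancel]
  rw [e1, e2, show n + 2 - 1 = n + 1 by omega] at h2
  apply Nat.eq_of_mul_eq_mul_right (Nat.succ_pos n)
  rw [Nat.succ_eq_add_one, ← h2, show n + 2 - 1 = n + 1 by omega]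
  ring

end Group

/-! ### The action of $G$ on the fibres and the Artin invariant -/

section Fibres

variable {F : Type*} [Field F] [Finite F] {L : Type*} [Field L] [Algebra F L]

theorem denom_ne_zero_of_pow_ne (g : GL (Fin 2) F) {v : L} (hv : v ^ Nat.card F ≠ v) :
    algebraMap F L (g 1 0) * v + algebraMap F L (g 1 1) ≠ 0 := by
  refine linear_ne_zero ?_ hv
  by_contra! h
  have := det_ne_zero_fin_two g
  simp [h.1, h.2] at this

theorem mk_smul_coe (g : GL (Fin 2) F) {v : L} (hv : v ^ Nat.card F ≠ v) :
    (ProjGenLinGroup.mk g : PGL(2, F)) • (v : OnePoint L) =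
      (((algebraMap F L (g 0 0) * v + algebraMap F L (g 0 1)) /
        (algebraMap F L (g 1 0) * v + algebraMap F L (g 1 1)) : L) : OnePoint L) := by
  rw [mk_smul, glAct_coe, if_neg (denom_ne_zero_of_pow_ne g hv)]

theorem value_smul (γ : PGL(2, F)) {v : L} (hv : v ^ Nat.card F ≠ v) :
    value (quotientMap F) (γ • (v : OnePoint L)) = value (quotientMap F) (v : OnePoint L) := by
  induction γ using ProjGenLinGroup.induction_on with | mk g =>
  have hx := denom_ne_zero_of_pow_ne g hv
  have hdet := det_ne_zero_fin_two g
  rw [mk_smul_coe g hv, value_quotientMap_coe F hv, value_quotientMap_coe,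
    quotientFun_mobius hdet hx]
  rw [← sub_ne_zero, mobius_pow_natCard_sub hx]
  exact div_ne_zero (mul_ne_zero ((map_ne_zero _).2 hdet) (sub_ne_zero.2 hv)) (pow_ne_zero _ hx)

/-- The fixed-point equation is a quadratic over $\mathbb F_q$ satisfied by $v\notin\mathbb
F_{q^2}$, so all its coefficients vanish and the matrix is scalar. -/
theorem eq_one_of_smul_eq {γ : PGL(2, F)} {v : L} (hv : v ^ Nat.card F ≠ v)
    (hv2 : v ^ Nat.card F ^ 2 ≠ v) (h : γ • (v : OnePoint L) = v) : γ = 1 := by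
  induction γ using ProjGenLinGroup.induction_on with | mk g =>
  rw [mk_smul_coe g hv, OnePoint.coe_eq_coe, div_eq_iff (denom_ne_zero_of_pow_ne g hv)] at h
  obtain ⟨h1, h2, h3⟩ := eq_zero_of_quadratic (a := g 1 0) (b := g 1 1 - g 0 0) (c := -g 0 1) hv hv2
    (by simp only [map_sub, map_neg]; linear_combination (-1) * h)
  rw [mk_eq_one_iff_fin_two]
  exact ⟨neg_eq_zero.1 h3, h1, (sub_eq_zero.1 h2).symm⟩

/-- `PGL₂(𝔽_q)` acts transitively on the fibres of the quotient map over nonzero values. -/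
theorem exists_smul_eq [IsAlgClosed L] {τ : L} (hτ : τ ≠ 0) {v : L} {w : OnePoint L}
    (hv : value (quotientMap F) (v : OnePoint L) = (τ : OnePoint L))
    (hw : value (quotientMap F) w = (τ : OnePoint L)) :
    ∃ γ : PGL(2, F), γ • (v : OnePoint L) = w := by
  have hv1 := pow_natCard_ne_of_value_eq_coe F hv
  have hv2 : v ^ Nat.card F ^ 2 ≠ v := by
    rw [ne_eq, ← quotientFun_eq_zero_iff F hv1, quotientFun_eq_of_value_eq_coe F hv]
    exact hτ
  have : Finite PGL(2, F) := Finite.of_surjective _ ProjGenLinGroup.mk_surjective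
  let f : PGL(2, F) → {w : OnePoint L // value (quotientMap F) w = (τ : OnePoint L)} :=
    fun γ ↦ ⟨γ • (v : OnePoint L), (value_smul γ hv1).trans hv⟩
  have hf : Function.Injective f := by
    intro γ δ h
    have h' : γ • (v : OnePoint L) = δ • (v : OnePoint L) := congrArg Subtype.val h
    have := eq_one_of_smul_eq (γ := δ⁻¹ * γ) hv1 hv2 (by rw [mul_smul, h', inv_smul_smul])
    exact (inv_mul_eq_one.1 this).symm
  have : Finite {w : OnePoint L // value (quotientMap F) w = (τ : OnePoint L)} := by
    -- `Nat.card` is 0 on infinite types, so a nonzero cardinality proves finiteness.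
    apply Nat.finite_of_card_ne_zero
    rw [natCard_fibre F hτ, ← natCard_PGL]
    exact Nat.card_pos.ne'
  -- The orbit map is injective because stabilizers are trivial, and the fibre has exactly $|G|$
  -- points, so the orbit fills the fibre.
  have hb := (Nat.bijective_iff_injective_and_card f).2
    ⟨hf, by rw [natCard_fibre F hτ, natCard_PGL]⟩
  obtain ⟨γ, hγ⟩ := hb.2 ⟨w, hw⟩
  exact ⟨γ, congrArg Subtype.val hγ⟩

/-- Frobenius commutes with $Q$, whose coefficients lie in $\mathbb F_q$, and fixes $\tau$. -/
theorem value_pow_natCard {τ : F} {v : L}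
    (h : value (quotientMap F) (v : OnePoint L) = ((algebraMap F L τ : L) : OnePoint L)) :
    value (quotientMap F) ((v ^ Nat.card F : L) : OnePoint L) =
      ((algebraMap F L τ : L) : OnePoint L) := by
  have hv := pow_natCard_ne_of_value_eq_coe F h
  have hw : (v ^ Nat.card F) ^ Nat.card F ≠ v ^ Nat.card F := by
    rw [← sub_ne_zero, ← sub_pow_natCard]
    exact pow_ne_zero _ (sub_ne_zero.2 hv)
  rw [value_quotientMap_coe F hw, OnePoint.coe_eq_coe, ← algebraMap_pow_natCard (R := L) τ,
    ← quotientFun_eq_of_value_eq_coe F h, quotientFun, quotientFun, div_pow,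
    pow_right_comm (v ^ Nat.card F ^ 2 - v), pow_right_comm (v ^ Nat.card F - v), sub_pow_natCard,
    sub_pow_natCard, pow_right_comm v]

theorem value_eq_iota {γ : PGL(2, F)} {v : L} (hv : v ^ Nat.card F ≠ v)
    (h : ((v ^ Nat.card F : L) : OnePoint L) = γ • (v : OnePoint L)) :
    value (quotientMap F) (v : OnePoint L) = ((algebraMap F L (iota γ) : L) : OnePoint L) := by
  induction γ using ProjGenLinGroup.induction_on with | mk g =>
  rw [mk_smul_coe g hv, OnePoint.coe_eq_coe] at h
  rw [value_quotientMap_coe F hv, quotientFun_eq_of_pow_natCard_eq (det_ne_zero_fin_two g) hv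
    (denom_ne_zero_of_pow_ne g hv) h, iota_mk, iotaGL]

/-- The fibres over $\infty$ and $0$ have at most $q+1$ and $q^2$ points, both less than
$q(q-1)(q+1)$ already for $q=2$. -/
theorem isRegular_iff [IsAlgClosed L] {τ : OnePoint L} :
    IsRegular (⊤ : Subgroup PGL(2, F)) (quotientMap F) τ ↔
      ¬ (τ = ((0 : L) : OnePoint L) ∨ τ = ∞) := by
  have hq := two_le_natCard (F := F)
  rw [IsRegular, Subgroup.card_top, natCard_PGL]
  induction τ using OnePoint.rec with
  | infty =>
    have h := natCard_fibre_infty_le F (E := L)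
    have h1 : 1 * (Nat.card F + 1) < Nat.card F * (Nat.card F - 1) * (Nat.card F + 1) := by
      apply Nat.mul_lt_mul_of_pos_right _ (Nat.succ_pos _)
      calc 1 < Nat.card F * 1 := by omega
        _ ≤ _ := Nat.mul_le_mul_left _ (by omega)
    simp only [or_true, not_true, iff_false]
    omega
  | coe τ =>
    by_cases hτ : τ = 0
    · subst hτ
      have h := natCard_fibre_zero_le F (E := L)
      have h1 : Nat.card F ^ 2 < Nat.card F * (Nat.card F - 1) * (Nat.card F + 1) := by
        obtain ⟨n, hn⟩ : ∃ n, Nat.card F = n + 2 := ⟨Nat.card F - 2, by omega⟩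
        rw [hn, show n + 2 - 1 = n + 1 by omega]
        nlinarith
      simp only [true_or, not_true, iff_false]
      omega
    · simp [natCard_fibre F hτ, hτ]

theorem mk_mem_classes_of_pow_natCard_eq {τ : F} (hτ : τ ≠ 0) {v : L}
    (hv : value (quotientMap F) (v : OnePoint L) = ((algebraMap F L τ : L) : OnePoint L))
    {γ : PGL(2, F)} (h : ((v ^ Nat.card F : L) : OnePoint L) = γ • (v : OnePoint L)) :
    ConjClasses.mk γ ∈ classesOrderGeThree F ∧ iotaClass (ConjClasses.mk γ) = τ := by
  have hv1 := pow_natCard_ne_of_value_eq_coe F hv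
  have hι : iota γ = τ := by
    have := (value_eq_iota hv1 h).symm.trans hv
    exact (algebraMap F L).injective (OnePoint.coe_injective this)
  refine ⟨⟨γ, three_le_orderOf_iff.2 ⟨?_, hι ▸ hτ⟩, rfl⟩, hι⟩
  rintro rfl
  rw [one_smul] at h
  exact hv1 (OnePoint.coe_injective h)

/-- Any $\gamma$ with $v^q=\gamma(v)$ on the fibre over $\tau$ has $\iota(\gamma)=\tau$, so
injectivity of $\iota$ identifies its class. Existence of $\gamma$ comes from transitivity applied
to $v$ and $v^q$. -/
theorem isArtinInvariant_iff [IsAlgClosed L] {τ : F} (hτ : τ ≠ 0) {C : ConjClasses PGL(2, F)} :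
    IsArtinInvariant L (quotientMap F) τ C ↔ C ∈ classesOrderGeThree F ∧ iotaClass C = τ := by
  have hτ' : algebraMap F L τ ≠ 0 := (map_ne_zero _).2 hτ
  have hreg : IsRegular (⊤ : Subgroup PGL(2, F)) (quotientMap F)
      ((algebraMap F L τ : L) : OnePoint L) := by
    rw [isRegular_iff]
    simp [hτ]
  have hex : ∀ v : L,
      value (quotientMap F) (v : OnePoint L) = ((algebraMap F L τ : L) : OnePoint L) →
      ∃ γ : PGL(2, F), ((v ^ Nat.card F : L) : OnePoint L) = γ • (v : OnePoint L) := fun v hv ↦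
    (exists_smul_eq hτ' hv (value_pow_natCard hv)).imp fun _ h ↦ h.symm
  constructor
  · rintro ⟨-, h⟩
    -- Over an empty fibre the condition on $C$ would be vacuous, so an actual point is needed to
    -- pin $C$ down.
    obtain ⟨v, hv⟩ : ∃ v : L,
        value (quotientMap F) (v : OnePoint L) = ((algebraMap F L τ : L) : OnePoint L) := by
      have hdeg : (fibrePoly F (algebraMap F L τ)).degree ≠ 0 := by
        intro h0
        have := natDegree_fibrePoly F (algebraMap F L τ)
        rw [Polynomial.natDegree_eq_of_degree_eq_some h0] at this
        exact (Nat.mul_pos (natCard_mul_pos F) (Nat.succ_pos _)).ne this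
      obtain ⟨v, hv⟩ := IsAlgClosed.exists_root _ hdeg
      exact ⟨v, (eval_fibrePoly_eq_zero_iff F).1 hv⟩
    obtain ⟨⟨γ, hγ⟩, hC⟩ := h v hv
    rw [← hC γ hγ]
    exact mk_mem_classes_of_pow_natCard_eq hτ hv hγ
  · rintro ⟨hC, hι⟩
    refine ⟨hreg, fun v hv ↦ ⟨hex v hv, fun γ hγ ↦ ?_⟩⟩
    obtain ⟨h1, h2⟩ := mk_mem_classes_of_pow_natCard_eq hτ hv hγ
    exact bijOn_iotaClass.injOn h1 hC (h2.trans hι.symm)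

theorem artinInvariant_spec [IsAlgClosed L] {τ : F} (hτ : τ ≠ 0) :
    artinInvariant L (quotientMap F) τ ∈ classesOrderGeThree F ∧
      iotaClass (artinInvariant L (quotientMap F) τ) = τ :=
  (isArtinInvariant_iff (L := L) hτ).1 (Classical.epsilon_spec
    ⟨_, (isArtinInvariant_iff hτ).2
      ⟨companion_mem_classesOrderGeThree hτ, iotaClass_companion hτ⟩⟩)

end Fibres

end PGL2Artin

theorem mainTheorem1 (F : Type*) [Field F] [Finite F]
    (L : Type*) [Field L] [Algebra F L] [IsAlgClosure F L] :
    -- `Q` is a quotient map for `PGL₂(𝔽_q)`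
    PGL2Artin.IsQuotientMap (⊤ : Subgroup PGL(2, F)) (PGL2Artin.quotientMap F) ∧
    -- its only irregular values are `0` and `∞`
    (∀ τ : OnePoint L,
      ¬ PGL2Artin.IsRegular (⊤ : Subgroup PGL(2, F)) (PGL2Artin.quotientMap F) τ ↔
        τ = ((0 : L) : OnePoint L) ∨ τ = OnePoint.infty) ∧
    -- `inv_Q` is well defined on nonzero elements
    (∀ τ : F, τ ≠ 0 →
      ∃! C, PGL2Artin.IsArtinInvariant L (PGL2Artin.quotientMap F) τ C) ∧
    -- `ι` is a bijection, with inverse bijection `inv_Q`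
    Set.BijOn PGL2Artin.iotaClass (PGL2Artin.classesOrderGeThree F) {τ : F | τ ≠ 0} ∧
    Set.BijOn (PGL2Artin.artinInvariant L (PGL2Artin.quotientMap F))
      {τ : F | τ ≠ 0} (PGL2Artin.classesOrderGeThree F) ∧
    Set.InvOn (PGL2Artin.artinInvariant L (PGL2Artin.quotientMap F)) PGL2Artin.iotaClass
      (PGL2Artin.classesOrderGeThree F) {τ : F | τ ≠ 0} ∧
    -- `v ^ q = γ(v)` implies `Q(v) = ι(γ)`
    (∀ γ : PGL(2, F), 3 ≤ orderOf γ → ∀ v : L, v ∉ Set.range (algebraMap F L) →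
      ((v ^ Nat.card F : L) : OnePoint L) = γ • (v : OnePoint L) →
      PGL2Artin.value (PGL2Artin.quotientMap F) (v : OnePoint L) =
        ((algebraMap F L (PGL2Artin.iota γ) : L) : OnePoint L)) := by

  have : IsAlgClosed L := IsAlgClosure.isAlgClosed F
  have hinv : Set.InvOn (PGL2Artin.artinInvariant L (PGL2Artin.quotientMap F))
      PGL2Artin.iotaClass (PGL2Artin.classesOrderGeThree F) {τ : F | τ ≠ 0} := by
    refine ⟨fun C hC ↦ ?_, fun τ hτ ↦ (PGL2Artin.artinInvariant_spec (L := L) hτ).2⟩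
    obtain ⟨h1, h2⟩ := PGL2Artin.artinInvariant_spec (L := L) (PGL2Artin.iotaClass_ne_zero hC)
    -- The class $\mathrm{inv}_Q(\iota(C))$ has order at least 3 and the same $\iota$ as $C$, so the
    -- two coincide.
    exact PGL2Artin.bijOn_iotaClass.injOn h1 hC h2
  refine ⟨⟨fun g _ ↦ PGL2Artin.eval_mobius_quotientMap F g, ?_, ?_⟩, fun τ ↦ ?_, fun τ hτ ↦ ?_,
    PGL2Artin.bijOn_iotaClass, hinv.symm.bijOn ?_ PGL2Artin.bijOn_iotaClass.mapsTo, hinv,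
    fun γ _ v hv h ↦ ?_⟩
  · rw [PGL2Artin.num_quotientMap, PGL2Artin.natDegree_numPoly, Subgroup.card_top,
      PGL2Artin.natCard_PGL]
  · rw [PGL2Artin.num_quotientMap, PGL2Artin.denom_quotientMap]
    exact PGL2Artin.natDegree_denomPoly_lt F F
  · rw [PGL2Artin.isRegular_iff, not_not]
  · refine ⟨_, (PGL2Artin.isArtinInvariant_iff hτ).2
      ⟨PGL2Artin.companion_mem_classesOrderGeThree hτ, PGL2Artin.iotaClass_companion hτ⟩,
      fun C hC ↦ ?_⟩
    obtain ⟨h1, h2⟩ := (PGL2Artin.isArtinInvariant_iff hτ).1 hC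
    exact PGL2Artin.eq_companion_of_mem_classesOrderGeThree h1 hτ h2
  · exact fun τ hτ ↦ (PGL2Artin.artinInvariant_spec hτ).1
  · exact PGL2Artin.value_eq_iota (mt (PGL2Artin.mem_range_of_pow_natCard_eq F) hv) h
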